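/- Let $M$ be a countable first-order structure, $G=\mathrm{Aut}(M)$, and for $X\subseteq M$ let $G_X$ be the group of all $g\in G$ fixing every element of $X$. Let $\mathrm{cl}$ be a closure operation on (the subsets of) $M$ which is - invariant: $\mathrm{cl}(gX)=g(\mathrm{cl}(X))$ for all $g\in G$, $X\subseteq M$; - finitary: $\mathrm{cl}(X)$ is the union of the sets $\mathrm{cl}(Y)$ over the finite subsets $Y$ of $X$, for all $X\subseteq M$; - such that it subsumes definable closure: if $X\subseteq M$ is finite and $a\in M$ is fixed by $G_{\mathrm{cl}(X)}$, then $a\in\mathrm{cl}(X)$. Let $\mathcal X=\{\mathrm{cl}(X): X\subseteq M \text{ finite}\}$, and let $\mathcal F$ be the set of bijections $f:A\to B$ with $A,B\in\mathcal X$ that extend to elements of $G$. For subsets $A,B$ and a tuple $a$, $\mathrm{cl}(a,B)$ is the closure of $B$ together with the entries of $a$; finite tuples are identified with the finite sets of their entries. Let $\mathop{\perp}$ be a stationary independence relation on $M$ compatible with $\mathrm{cl}$, i.e. a ternary relation $A\perp_B C$ such that, for all $A,B,C,D,A_1,A_2\in\mathcal X$ and all finite tuples $a,b$ from $M$: 1.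 (Compatibility) $a\perp_b C\Leftrightarrow a\perp_{\mathrm{cl}(b)}C$, and $a\perp_B C \Leftrightarrow (e\perp_B C$ for all finite tuples $e$ from $\mathrm{cl}(a,B)) \Leftrightarrow \mathrm{cl}(a,B)\perp_B C$. 2. (Invariance) If $g\in G$ and $A\perp_B C$, then $gA\perp_{gB}gC$. 3. (Monotonicity) If $A\perp_B \mathrm{cl}(C\cup D)$, then $A\perp_B C$ and $A\perp_{\mathrm{cl}(B\cup C)}D$. 4. (Transitivity) If $A\perp_B C$ and $A\perp_{\mathrm{cl}(B\cup C)}D$, then $A\perp_B\mathrm{cl}(C\cup D)$. 5. (Symmetry) If $A\perp_B C$, then $C\perp_B A$. 6. (Existence) There is $g\in G_B$ with $gA\perp_B C$. 7. (Stationarity) If $B\subseteq A_i$ and $A_i\perp_B C$ for $i=1,2$, and $h:A_1\to A_2$ in $\mathcal F$ is the identity on $B$, then there is $k\in\mathcal F$ extending both $h$ and the identity map on $C$. Suppose that every element of $G$ fixes every element of $\mathrm{cl}(\emptyset)$. Let $g\in G$ move almost maximally: for all $B\in\mathcal X$ and $a\in M$ there is $a'$ in the $G_B$-orbit of $a$ such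 that $a'\perp_B \mathrm{cl}(ga')$. Then every element of $G$ is a product of 16 conjugates of $g$ in $G$. -/

import Mathlib

open scoped FirstOrder

universe u v w

/-- `Aut(M)`: the `L`-automorphisms of `M`, as a group under composition, `(f * g) x = f (g x)`. -/
instance autGroup {L : FirstOrder.Language.{u, v}} {M : Type w} [L.Structure M] : Group (M ≃[L] M) where
  mul f g := f.comp g
  one := FirstOrder.Language.Equiv.refl L M
  inv f := f.symm
  mul_assoc _ _ _ := rfl
  one_mul _ := rfl
  mul_one _ := rfl
  inv_mul_cancel f := FirstOrder.Language.Equiv.ext fun x => f.symm_apply_apply x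

namespace StatIndep

variable {L : FirstOrder.Language.{u, v}} {M : Type w} [L.Structure M]

/-- `g ∈ G_X`: the automorphism `g` fixes every element of `X`. -/
def Fixes (g : M ≃[L] M) (X : Set M) : Prop :=
  ∀ x ∈ X, g x = x

variable (L) in
/-- `cl(gX) = g(cl(X))` for all automorphisms `g` and all `X ⊆ M`. -/
def IsInvariant (cl : ClosureOperator (Set M)) : Prop :=
  ∀ (g : M ≃[L] M) (X : Set M), cl (g '' X) = g '' cl X

/-- `cl(X)` is the union of the closures of the finite subsets of `X`. -/
def IsFinitary (cl : ClosureOperator (Set M)) : Prop :=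
  ∀ X : Set M, cl X = ⋃ Y ∈ {Y : Set M | Y ⊆ X ∧ Y.Finite}, cl Y

variable (L) in
/-- Every element fixed by `G_{cl(X)}`, for `X` finite, lies in `cl(X)`. -/
def SubsumesDcl (cl : ClosureOperator (Set M)) : Prop :=
  ∀ X : Set M, X.Finite → ∀ a : M,
    (∀ g : M ≃[L] M, Fixes g (cl X) → g a = a) → a ∈ cl X

/-- The set `𝒳` of closures of finite subsets of `M`. -/
def finClosed (cl : ClosureOperator (Set M)) : Set (Set M) :=
  {A | ∃ X : Set M, X.Finite ∧ A = cl X}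

variable (L) in
/-- `Ind A B C` is read "`A` is independent from `C` over `B`". Finite tuples are represented by
the finite sets of their entries. All axioms concern elements of `𝒳` and finite tuples only; a
juxtaposition such as `CD` of elements of `𝒳` stands for the element `cl(C ∪ D)` of `𝒳`. -/
structure IsStationaryIndep (cl : ClosureOperator (Set M))
    (Ind : Set M → Set M → Set M → Prop) : Prop where
  compat_base : ∀ a b : Set M, a.Finite → b.Finite → ∀ C ∈ finClosed cl,
    (Ind a b C ↔ Ind a (cl b) C)
  /-- Here `e` ranges over the finite tuples from `cl(a, B)`. -/
  compat_tuples : ∀ a : Set M, a.Finite → ∀ B ∈ finClosed cl, ∀ C ∈ finClosed cl,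
    (Ind a B C ↔ ∀ e : Set M, e.Finite → e ⊆ cl (a ∪ B) → Ind e B C)
  compat_closure : ∀ a : Set M, a.Finite → ∀ B ∈ finClosed cl, ∀ C ∈ finClosed cl,
    (Ind a B C ↔ Ind (cl (a ∪ B)) B C)
  invariance : ∀ g : M ≃[L] M,
    ∀ A ∈ finClosed cl, ∀ B ∈ finClosed cl, ∀ C ∈ finClosed cl,
      Ind A B C → Ind (g '' A) (g '' B) (g '' C)
  monotonicity : ∀ A ∈ finClosed cl, ∀ B ∈ finClosed cl,
    ∀ C ∈ finClosed cl, ∀ D ∈ finClosed cl,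
      Ind A B (cl (C ∪ D)) → Ind A B C ∧ Ind A (cl (B ∪ C)) D
  transitivity : ∀ A ∈ finClosed cl, ∀ B ∈ finClosed cl,
    ∀ C ∈ finClosed cl, ∀ D ∈ finClosed cl,
      Ind A B C → Ind A (cl (B ∪ C)) D → Ind A B (cl (C ∪ D))
  symmetry : ∀ A ∈ finClosed cl, ∀ B ∈ finClosed cl, ∀ C ∈ finClosed cl,
    Ind A B C → Ind C B A
  existence : ∀ A ∈ finClosed cl, ∀ B ∈ finClosed cl, ∀ C ∈ finClosed cl,
    ∃ g : M ≃[L] M, Fixes g B ∧ Ind (g '' A) B C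
  /-- A partial automorphism `A₁ → A₂` is the restriction to `A₁` of some `h ∈ G` with
  `h(A₁) = A₂`; the extension of `h|A₁ ∪ id_C` is the restriction of `k` to `cl(A₁ ∪ C)`. -/
  stationarity : ∀ A₁ ∈ finClosed cl, ∀ A₂ ∈ finClosed cl,
    ∀ B ∈ finClosed cl, ∀ C ∈ finClosed cl,
      B ⊆ A₁ → B ⊆ A₂ → Ind A₁ B C → Ind A₂ B C →
      ∀ h : M ≃[L] M, h '' A₁ = A₂ → Fixes h B →
        ∃ k : M ≃[L] M, (∀ x ∈ A₁, k x = h x) ∧ Fixes k C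

/-- For all `B ∈ 𝒳` and `a ∈ M` there is `a'` in the `G_B`-orbit of `a` that is independent from
`g a'` over `B`. As the right-hand argument of the independence relation is an element of `𝒳`, the
element `g a'` is represented there by its closure. -/
def MovesAlmostMaximally (cl : ClosureOperator (Set M))
    (Ind : Set M → Set M → Set M → Prop) (g : M ≃[L] M) : Prop :=
  ∀ B ∈ finClosed cl, ∀ a : M, ∃ f : M ≃[L] M, Fixes f B ∧
    Ind {f a} B (cl {g (f a)})

end StatIndep


/-!
Give `G` the topology whose basic neighbourhoods of the identity are the pointwise stabilisers of
closures of finite sets; it is completely metrisable. For fixed `γ`, consider the map sending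
`(h₁, …, h₄)` to the product of the conjugates `hᵢ⁻¹ γ hᵢ`. When `γ` moves maximally, stationarity
lets finite approximations of an element be extended through the four factors, so that images of
open sets are dense in open sets. Shrinking open sets alternately for this map and for its
translate by `k` after inversion produces a common value, which writes `k` as a product of eight
conjugates of `γ`. Finally, if `g` moves almost maximally, then for a generic `h` the element
`h⁻¹ g h g`, a product of two conjugates of `g`, moves maximally.
-/

namespace StatIndep

open Filter Set Topology TopologicalSpace
open scoped Pointwise

section NearlyFeeblyOpen

/-- A map is nearly feebly open if the image of every nonempty open set is dense in some nonempty
open set. For continuous maps between Polish spaces this replaces openness in the proof that two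
maps have a common value. -/
def IsNearlyFeeblyOpen {X Y : Type*} [TopologicalSpace X] [TopologicalSpace Y] (f : X → Y) : Prop :=
  ∀ U : Set X, IsOpen U → U.Nonempty → (interior (closure (f '' U))).Nonempty

theorem IsNearlyFeeblyOpen.homeomorph_comp {X Y Z : Type*} [TopologicalSpace X]
    [TopologicalSpace Y] [TopologicalSpace Z] {f : X → Y} (hf : IsNearlyFeeblyOpen f) (e : Y ≃ₜ Z) :
    IsNearlyFeeblyOpen (e ∘ f) := fun U hU hne => by
  rw [image_comp, ← e.image_closure, ← e.image_interior]
  exact (hf U hU hne).image e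

theorem exists_forall_mem_nhds_of_shrinking {Z : Type*} [PseudoMetricSpace Z] [CompleteSpace Z]
    {P : Set Z → Prop} (hne : ∀ W, P W → W.Nonempty)
    (hP : ∀ W, P W → ∀ ε > 0, ∃ V ⊆ W, P V ∧ ∃ z, V ⊆ Metric.ball z ε) {W : Set Z} (hW : P W) :
    ∃ z, ∀ U ∈ 𝓝 z, ∃ V ⊆ U, P V := by
  choose! next next_subset hnext using hP
  let s : ℕ → Set Z := fun n => Nat.rec W (fun n V => next V (1 / (n + 1))) n
  have hε (n : ℕ) : (0 : ℝ) < 1 / (n + 1) := Nat.one_div_pos_of_nat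
  have hs (n : ℕ) : P (s n) := by
    induction n with
    | zero => exact hW
    | succ n ih => exact (hnext _ ih _ (hε n)).1
  have hanti : Antitone s := antitone_nat_of_succ_le fun n => next_subset _ (hs n) _ (hε n)
  have hbasis : (⨅ n, 𝓟 (s n)).HasBasis (fun _ => True) s :=
    hasBasis_iInf_principal (directed_of_isDirected_le hanti)
  have hcauchy : Cauchy (⨅ n, 𝓟 (s n)) := by
    refine Metric.cauchy_iff.2 ⟨hbasis.neBot_iff.2 fun {n} _ => hne _ (hs n), fun ε hε' => ?_⟩
    obtain ⟨n, hn⟩ := exists_nat_one_div_lt (half_pos hε')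
    obtain ⟨z, hz⟩ := (hnext _ (hs n) _ (hε n)).2
    refine ⟨s (n + 1), hbasis.mem_of_mem (i := n + 1) trivial, fun x hx y hy => ?_⟩
    linarith [dist_triangle_right x y z, Metric.mem_ball.1 (hz hx), Metric.mem_ball.1 (hz hy)]
  obtain ⟨z, hz⟩ := CompleteSpace.complete hcauchy
  refine ⟨z, fun U hU => ?_⟩
  obtain ⟨n, -, hn⟩ := hbasis.mem_iff.1 (hz hU)
  exact ⟨s n, hn, hs n⟩

/-- The images of `U` under `φ` and of `V` under `ψ` are both dense in some common nonempty open
set. Pairs of open sets with this property are shrunk to a common value of `φ` and `ψ`. -/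
def AreLinked {X X' Y : Type*} [TopologicalSpace Y] (φ : X → Y) (ψ : X' → Y) (U : Set X)
    (V : Set X') : Prop :=
  (interior (closure (φ '' U)) ∩ interior (closure (ψ '' V))).Nonempty

namespace AreLinked

variable {X X' Y : Type*} [TopologicalSpace Y] {φ : X → Y} {ψ : X' → Y} {U : Set X} {V : Set X'}

theorem symm (h : AreLinked φ ψ U V) : AreLinked ψ φ V U := by
  rwa [AreLinked, inter_comm]

theorem nonempty_left (h : AreLinked φ ψ U V) : U.Nonempty := by
  obtain ⟨y, hy, -⟩ := h
  exact image_nonempty.1 (closure_nonempty_iff.1 ⟨y, interior_subset hy⟩)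

theorem exists_shrink_left [PseudoMetricSpace X] (hφ : Continuous φ) (hφ' : IsNearlyFeeblyOpen φ)
    (h : AreLinked φ ψ U V) (hU : IsOpen U) {ε : ℝ} (hε : 0 < ε) :
    ∃ U' ⊆ U, IsOpen U' ∧ AreLinked φ ψ U' V ∧ ∃ x, U' ⊆ Metric.ball x ε := by
  set O := interior (closure (φ '' U)) ∩ interior (closure (ψ '' V))
  have hOopen : IsOpen O := isOpen_interior.inter isOpen_interior
  obtain ⟨_, hxO, x, hxU, rfl⟩ : (O ∩ φ '' U).Nonempty := by
    obtain ⟨y, hy⟩ := h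
    exact mem_closure_iff.1 (interior_subset hy.1) O hOopen hy
  have hopen : IsOpen (U ∩ φ ⁻¹' O ∩ Metric.ball x ε) :=
    (hU.inter (hOopen.preimage hφ)).inter Metric.isOpen_ball
  obtain ⟨y, hy⟩ := hφ' _ hopen ⟨x, ⟨hxU, hxO⟩, Metric.mem_ball_self hε⟩
  have himage : φ '' (U ∩ φ ⁻¹' O ∩ Metric.ball x ε) ⊆ closure (ψ '' V) := by
    rintro _ ⟨z, ⟨⟨-, hz⟩, -⟩, rfl⟩
    exact interior_subset hz.2
  have hle := interior_mono (closure_minimal himage isClosed_closure)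
  exact ⟨_, fun z hz => hz.1.1, hopen, ⟨y, hy, hle hy⟩, x, inter_subset_right⟩

end AreLinked

theorem exists_eq_of_isNearlyFeeblyOpen {X X' Y : Type*} [TopologicalSpace X]
    [IsCompletelyPseudoMetrizableSpace X] [TopologicalSpace X']
    [IsCompletelyPseudoMetrizableSpace X'] [Nonempty X'] [TopologicalSpace Y] [T2Space Y]
    {φ : X → Y} {ψ : X' → Y} (hφ : Continuous φ) (hψ : Continuous ψ) (hφ' : IsNearlyFeeblyOpen φ)
    (hψ' : IsNearlyFeeblyOpen ψ) (hdense : DenseRange φ) : ∃ x x', φ x = ψ x' := by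
  let := upgradeIsCompletelyPseudoMetrizable X
  let := upgradeIsCompletelyPseudoMetrizable X'
  let P : Set (X × X') → Prop := fun W =>
    ∃ U V, W = U ×ˢ V ∧ IsOpen U ∧ IsOpen V ∧ AreLinked φ ψ U V
  have hne (W) : P W → W.Nonempty := by
    rintro ⟨U, V, rfl, -, -, h⟩
    exact h.nonempty_left.prod h.symm.nonempty_left
  have hshrink (W) : P W → ∀ ε > 0, ∃ W' ⊆ W, P W' ∧ ∃ z, W' ⊆ Metric.ball z ε := by
    rintro ⟨U, V, rfl, hU, hV, h⟩ ε hε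
    obtain ⟨U', hUU', hU', h', x, hx⟩ := h.exists_shrink_left hφ hφ' hU hε
    obtain ⟨V', hVV', hV', h'', x', hx'⟩ := h'.symm.exists_shrink_left hψ hψ' hV hε
    refine ⟨U' ×ˢ V', prod_mono hUU' hVV', ⟨U', V', rfl, hU', hV', h''.symm⟩, (x, x'), ?_⟩
    rw [← ball_prod_same]
    exact prod_mono hx hx'
  have huniv : P univ := by
    refine ⟨univ, univ, univ_prod_univ.symm, isOpen_univ, isOpen_univ, ?_⟩
    rw [AreLinked, image_univ, hdense.closure_range, interior_univ, univ_inter]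
    exact hψ' univ isOpen_univ univ_nonempty
  obtain ⟨⟨x, x'⟩, hx⟩ := exists_forall_mem_nhds_of_shrinking hne hshrink huniv
  refine ⟨x, x', by_contra fun hxx' => ?_⟩
  obtain ⟨A, B, hA, hB, hxA, hxB, hAB⟩ := t2_separation hxx'
  have hnhds : (φ ⁻¹' A) ×ˢ (ψ ⁻¹' B) ∈ 𝓝 (x, x') :=
    prod_mem_nhds ((hA.preimage hφ).mem_nhds hxA) ((hB.preimage hψ).mem_nhds hxB)
  obtain ⟨_, hsub, U, V, rfl, -, -, hlinked⟩ := hx _ hnhds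
  obtain ⟨hUA, hVB⟩ := (prod_subset_prod_iff.1 hsub).resolve_right fun h =>
    h.elim hlinked.nonempty_left.ne_empty hlinked.symm.nonempty_left.ne_empty
  obtain ⟨y, hyU, hyV⟩ := hlinked
  have hdisj : Disjoint (interior (closure A)) (closure B) :=
    ((hAB.closure_left hB).mono_left interior_subset).closure_right isOpen_interior
  exact hdisj.ne_of_mem (interior_mono (closure_mono (image_subset_iff.2 hUA)) hyU)
    (closure_mono (image_subset_iff.2 hVB) (interior_subset hyV)) rfl

end NearlyFeeblyOpen

section AgreeOn

variable {G M : Type*} [Group G] [MulAction G M] {cl : ClosureOperator (Set M)}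

/-- `g` and `h` agree on the closure of the finite set `F`. -/
def AgreeOn (cl : ClosureOperator (Set M)) (g h : G) (F : Finset M) : Prop :=
  ∀ x ∈ cl (F : Set M), g • x = h • x

variable (G cl) in
/-- The closure operator commutes with the action of `G`. -/
class IsEquivariant : Prop where
  closure_smul (g : G) (X : Set M) : cl (g • X) = g • cl X

namespace AgreeOn

variable {g h k : G} {E F : Finset M}

theorem refl (g : G) (F : Finset M) : AgreeOn cl g g F := fun _ _ => rfl

theorem symm (H : AgreeOn cl g h F) : AgreeOn cl h g F := fun x hx => (H x hx).symm

theorem trans (H : AgreeOn cl g h F) (H' : AgreeOn cl h k F) : AgreeOn cl g k F :=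
  fun x hx => (H x hx).trans (H' x hx)

theorem mono (H : AgreeOn cl g h F) (hE : E ⊆ F) : AgreeOn cl g h E :=
  fun x hx => H x (cl.monotone (Finset.coe_subset.2 hE) hx)

theorem smul_eq (H : AgreeOn cl g h F) {x : M} (hx : x ∈ F) : g • x = h • x :=
  H x (cl.le_closure _ hx)

theorem mul_left (H : AgreeOn cl g h F) (k : G) : AgreeOn cl (k * g) (k * h) F :=
  fun x hx => by rw [mul_smul, mul_smul, H x hx]

theorem inv_one (H : AgreeOn cl g 1 F) : AgreeOn cl g⁻¹ 1 F := by
  simpa using (H.mul_left g⁻¹).symm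

theorem mul_one_right (H : AgreeOn cl g 1 F) (k : G) : AgreeOn cl (k * g) k F := by
  simpa using H.mul_left k

variable [DecidableEq M]

theorem smul_finset_eq (H : AgreeOn cl g h F) (hE : E ⊆ F) : g • E = h • E :=
  Finset.image_congr fun _ hx => H.smul_eq (hE hx)

theorem smul_finset_eq_self (H : AgreeOn cl g 1 F) (hE : E ⊆ F) : g • E = E := by
  rw [H.smul_finset_eq hE, one_smul]

variable [IsEquivariant G cl]

theorem mul_right {k : G} (H : AgreeOn cl g h (k • F)) : AgreeOn cl (g * k) (h * k) F :=
  fun x hx => by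
    rw [mul_smul, mul_smul]
    refine H _ ?_
    rw [Finset.coe_smul_finset, IsEquivariant.closure_smul]
    exact smul_mem_smul_set hx

theorem mul {g' h' : G} (H : AgreeOn cl g h (g' • F)) (H' : AgreeOn cl g' h' F) :
    AgreeOn cl (g * g') (h * h') F :=
  H.mul_right.trans (H'.mul_left h)

theorem inv (H : AgreeOn cl g h F) : AgreeOn cl g⁻¹ h⁻¹ (g • F) := by
  refine fun x hx => eq_inv_smul_iff.2 ?_
  rw [Finset.coe_smul_finset, IsEquivariant.closure_smul, mem_smul_set_iff_inv_smul_mem] at hx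
  rw [← H _ hx, smul_inv_smul]

theorem conj (H : AgreeOn cl h 1 (F ∪ g • F)) : AgreeOn cl (h⁻¹ * g * h) g F := by
  have hF := (H.mono Finset.subset_union_left).mul_one_right (h⁻¹ * g)
  simpa using hF.trans (H.mono Finset.subset_union_right).inv_one.mul_right

end AgreeOn

section Topology

variable [DecidableEq M]

variable (G cl) in
/-- The pointwise stabilisers of the sets `cl F`, `F` finite, as a basis of neighbourhoods of the
identity for a group topology. -/
@[reducible]
def fixatorFilterBasis [IsEquivariant G cl] : GroupFilterBasis G where
  sets := range fun F : Finset M => {g : G | AgreeOn cl g 1 F}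
  nonempty := range_nonempty _
  inter_sets := by
    rintro _ _ ⟨E, rfl⟩ ⟨F, rfl⟩
    exact ⟨_, ⟨E ∪ F, rfl⟩, fun g hg =>
      ⟨hg.mono Finset.subset_union_left, hg.mono Finset.subset_union_right⟩⟩
  one' := by
    rintro _ ⟨F, rfl⟩
    exact AgreeOn.refl 1 F
  mul' := by
    rintro _ ⟨F, rfl⟩
    refine ⟨_, ⟨F, rfl⟩, ?_⟩
    rintro _ ⟨g, hg, h, hh, rfl⟩
    exact (hh.mul_one_right g).trans hg
  inv' := by
    rintro _ ⟨F, rfl⟩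
    exact ⟨_, ⟨F, rfl⟩, fun g hg => hg.inv_one⟩
  conj' := by
    rintro k _ ⟨F, rfl⟩
    refine ⟨_, ⟨k⁻¹ • F, rfl⟩, fun g hg => ?_⟩
    simpa using (AgreeOn.mul_left hg k).mul_right

variable (G cl) in
/-- The pointwise stabilisers of the sets `cl F`, `F` finite, form a basis of neighbourhoods of the
identity of `G`. -/
class HasFixatorTopology [TopologicalSpace G] : Prop where
  nhds_one_hasBasis :
    (𝓝 (1 : G)).HasBasis (fun _ : Finset M => True) fun F => {g | AgreeOn cl g 1 F}

theorem hasFixatorTopology_fixatorFilterBasis [IsEquivariant G cl] :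
    letI := (fixatorFilterBasis G cl).topology
    HasFixatorTopology G cl := by
  let := (fixatorFilterBasis G cl).topology
  exact ⟨(fixatorFilterBasis G cl).nhds_one_hasBasis.to_hasBasis
    (by rintro _ ⟨F, rfl⟩; exact ⟨F, trivial, subset_rfl⟩) fun F _ => ⟨_, ⟨F, rfl⟩, subset_rfl⟩⟩

end Topology

section HasFixatorTopology

variable [TopologicalSpace G] [IsTopologicalGroup G] [HasFixatorTopology G cl]

variable (cl) in
theorem nhds_hasBasis_agreeOn (g : G) :
    (𝓝 g).HasBasis (fun _ : Finset M => True) fun F => {h | AgreeOn cl h g F} := by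
  rw [← map_mul_left_nhds_one g]
  refine ((HasFixatorTopology.nhds_one_hasBasis (cl := cl)).map (g * ·)).congr
    (fun _ => Iff.rfl) fun F _ => ?_
  rw [image_mul_left]
  ext h
  exact ⟨fun H => by simpa using AgreeOn.mul_left H g, fun H => by simpa using H.mul_left g⁻¹⟩

theorem isOpen_iff_agreeOn {U : Set G} :
    IsOpen U ↔ ∀ g ∈ U, ∃ F : Finset M, ∀ h, AgreeOn cl h g F → h ∈ U := by
  simp only [isOpen_iff_mem_nhds, (nhds_hasBasis_agreeOn cl _).mem_iff, true_and]
  rfl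

theorem exists_agreeOn_of_mem_nhds_pi {ι : Type*} [Finite ι] {p : ι → G} {U : Set (ι → G)}
    (hU : U ∈ 𝓝 p) :
    ∃ F : Finset M, ∀ q : ι → G, (∀ i, AgreeOn cl (q i) (p i) F) → q ∈ U := by
  classical
  cases nonempty_fintype ι
  rw [nhds_pi, mem_pi'] at hU
  obtain ⟨J, V, hV, hVU⟩ := hU
  choose F _ hF using fun i => (nhds_hasBasis_agreeOn cl (p i)).mem_iff.1 (hV i)
  exact ⟨Finset.univ.biUnion F, fun q hq => hVU fun i _ =>
    hF i ((hq i).mono (Finset.subset_biUnion_of_mem F (Finset.mem_univ i)))⟩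

theorem mem_closure_iff_agreeOn {S : Set G} {g : G} :
    g ∈ closure S ↔ ∀ F : Finset M, ∃ h ∈ S, AgreeOn cl h g F := by
  simp only [mem_closure_iff_nhds_basis (nhds_hasBasis_agreeOn cl g), true_implies]
  rfl

theorem t2Space_of_hasFixatorTopology (cl : ClosureOperator (Set M)) [HasFixatorTopology G cl]
    [FaithfulSMul G M] : T2Space G := by
  refine IsTopologicalGroup.t2Space_of_one_sep fun g hg => ?_
  obtain ⟨x, hx⟩ : ∃ x : M, g • x ≠ x := by
    by_contra! h
    exact hg (FaithfulSMul.eq_of_smul_eq_smul fun x : M => by simpa using h x)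
  refine ⟨_, HasFixatorTopology.nhds_one_hasBasis (cl := cl).mem_of_mem (i := {x}) trivial, ?_⟩
  exact fun h => hx (by simpa using h.smul_eq (Finset.mem_singleton_self x))

variable (G M) in
/-- A sequence in `G` whose terms and their inverses are eventually constant at every point of `M`
has a limit in `G`. -/
def HasPointwiseLimits : Prop :=
  ∀ u : ℕ → G, (∀ x : M, ∃ y, ∀ᶠ n in atTop, u n • x = y) →
    (∀ x : M, ∃ y, ∀ᶠ n in atTop, (u n)⁻¹ • x = y) →
    ∃ l : G, ∀ x : M, ∀ᶠ n in atTop, u n • x = l • x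

theorem HasPointwiseLimits.exists_tendsto (hlim : HasPointwiseLimits G M)
    {u : ℕ → G} (hu : ∀ F : Finset M, ∃ N, ∀ m ≥ N, ∀ n ≥ N, AgreeOn cl (u n) (u m) F)
    (hu' : ∀ F : Finset M, ∃ N, ∀ m ≥ N, ∀ n ≥ N, AgreeOn cl (u n)⁻¹ (u m)⁻¹ F) :
    ∃ l, Tendsto u atTop (𝓝 l) := by
  have eventually_const {v : ℕ → G}
      (hv : ∀ F : Finset M, ∃ N, ∀ m ≥ N, ∀ n ≥ N, AgreeOn cl (v n) (v m) F) (x : M) :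
      ∃ y, ∀ᶠ n in atTop, v n • x = y := by
    obtain ⟨N, hN⟩ := hv {x}
    exact ⟨v N • x, eventually_atTop.2
      ⟨N, fun n hn => (hN N le_rfl n hn).smul_eq (Finset.mem_singleton_self x)⟩⟩
  obtain ⟨l, hl⟩ := hlim u (eventually_const hu) (eventually_const hu')
  refine ⟨l, (nhds_hasBasis_agreeOn cl l).tendsto_right_iff.2 fun F _ => ?_⟩
  obtain ⟨N, hN⟩ := hu F
  filter_upwards [eventually_ge_atTop N] with m hm x hx
  obtain ⟨n, hn, hxn⟩ := ((eventually_ge_atTop N).and (hl x)).exists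
  exact (hN n hn m hm x hx).trans hxn

theorem HasPointwiseLimits.isCompletelyPseudoMetrizableSpace [Countable M]
    (cl : ClosureOperator (Set M)) [HasFixatorTopology G cl] (hlim : HasPointwiseLimits G M) :
    IsCompletelyPseudoMetrizableSpace G := by
  -- The left uniformity alone need not be complete, so we take the two-sided one.
  let : UniformSpace G := (IsTopologicalGroup.leftUniformSpace G ⊓
    IsTopologicalGroup.rightUniformSpace G).replaceTopology (inf_idem _).symm
  have hbasis := HasFixatorTopology.nhds_one_hasBasis (G := G) (cl := cl)
  have : (𝓝 (1 : G)).IsCountablyGenerated := hbasis.isCountablyGenerated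
  have hcountable : (uniformity G).IsCountablyGenerated :=
    inferInstanceAs (comap _ (𝓝 1) ⊓ comap _ (𝓝 1)).IsCountablyGenerated
  have hcomplete : CompleteSpace G := by
    refine UniformSpace.complete_of_cauchySeq_tendsto fun u hu =>
      hlim.exists_tendsto (cl := cl) (fun F => ?_) fun F => ?_
    · obtain ⟨N, hN⟩ := cauchySeq_iff.1 hu _
        (mem_inf_of_left (preimage_mem_comap (hbasis.mem_of_mem (i := F) trivial)))
      exact ⟨N, fun m hm n hn => by simpa using AgreeOn.mul_left (hN m hm n hn) (u m)⟩
    · obtain ⟨N, hN⟩ := cauchySeq_iff.1 hu _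
        (mem_inf_of_right (preimage_mem_comap (hbasis.mem_of_mem (i := F) trivial)))
      exact ⟨N, fun m hm n hn => by simpa using (AgreeOn.mul_left (hN m hm n hn) (u n)⁻¹).symm⟩
  infer_instance

end HasFixatorTopology

end AgreeOn

section Independence

variable {G M : Type*} [Group G] [MulAction G M] [DecidableEq M] {cl : ClosureOperator (Set M)}
  {I : Finset M → Finset M → Finset M → Prop} {A B C D : Finset M}

variable (G cl I) in
/-- The properties of `A ⊥_B C` between closures of finite sets: `I A B C` stands for
`cl A ⊥_{cl B} cl C`. -/
structure IsFinsetIndep : Prop where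
  smul (g : G) {A B C : Finset M} : I A B C → I (g • A) (g • B) (g • C)
  symm {A B C : Finset M} : I A B C → I C B A
  union_iff {A B C D : Finset M} : I A B (C ∪ D) ↔ I A B C ∧ I A (B ∪ C) D
  self_right (A B : Finset M) : I A B B
  existence (A B C : Finset M) : ∃ g : G, AgreeOn cl g 1 B ∧ I (g • A) B C
  stationarity {A B C : Finset M} {h : G} : AgreeOn cl h 1 B → I A B C → I (h • A) B C →
    ∃ k : G, AgreeOn cl k h (A ∪ B) ∧ AgreeOn cl k 1 C

namespace IsFinsetIndep

theorem mono (hI : IsFinsetIndep G cl I) (H : I A B D) (hC : C ⊆ D) : I A B C :=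
  (hI.union_iff.1 (by rwa [Finset.union_eq_right.2 hC])).1

theorem mono_left (hI : IsFinsetIndep G cl I) (H : I D B C) (hA : A ⊆ D) : I A B C :=
  hI.symm (hI.mono (hI.symm H) hA)

theorem base_of_union (hI : IsFinsetIndep G cl I) (H : I A B (C ∪ D)) : I A (B ∪ C) D :=
  (hI.union_iff.1 H).2

theorem trans (hI : IsFinsetIndep G cl I) (H : I A B C) (H' : I A (B ∪ C) D) : I A B (C ∪ D) :=
  hI.union_iff.2 ⟨H, H'⟩

theorem trans_of_subset (hI : IsFinsetIndep G cl I) (hBC : B ⊆ C) (H : I A B C) (H' : I A C D) :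
    I A B (C ∪ D) :=
  hI.trans H (by rwa [Finset.union_eq_right.2 hBC])

theorem base_mono (hI : IsFinsetIndep G cl I) (H : I A B D) (hBC : B ⊆ C) (hCD : C ⊆ D) :
    I A C D := by
  have := hI.base_of_union (C := C) (D := D) (by rwa [Finset.union_eq_right.2 hCD])
  rwa [Finset.union_eq_right.2 hBC] at this

theorem union_base (hI : IsFinsetIndep G cl I) (H : I A B C) : I A B (B ∪ C) :=
  hI.trans_of_subset subset_rfl (hI.self_right A B) H

theorem smul_of_agreeOn (hI : IsFinsetIndep G cl I) {u : G} (H : I A B C)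
    (hB : AgreeOn cl u 1 B) (hC : AgreeOn cl u 1 C) : I (u • A) B C := by
  simpa only [hB.smul_finset_eq_self subset_rfl, hC.smul_finset_eq_self subset_rfl]
    using hI.smul u H

theorem exists_extension (hI : IsFinsetIndep G cl I) (hBC : B ⊆ C) (H : I A B C) (D : Finset M) :
    ∃ u : G, AgreeOn cl u 1 C ∧ I (u • A) B (C ∪ D) := by
  obtain ⟨u, hu, hu'⟩ := hI.existence A C D
  exact ⟨u, hu, hI.trans_of_subset hBC (hI.smul_of_agreeOn H (hu.mono hBC) hu) hu'⟩

theorem stationarity_map (hI : IsFinsetIndep G cl I) {h m : G} (hm : AgreeOn cl h m B)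
    (H : I A B C) (H' : I (h • A) (h • B) (m • C)) :
    ∃ k : G, AgreeOn cl k h (A ∪ B) ∧ AgreeOn cl k m C := by
  have hB : AgreeOn cl (m⁻¹ * h) 1 B := by simpa using hm.mul_left m⁻¹
  have hindep : I ((m⁻¹ * h) • A) B C := by
    simpa only [smul_smul, inv_mul_cancel, one_smul, hB.smul_finset_eq_self subset_rfl]
      using hI.smul m⁻¹ H'
  obtain ⟨k, hk, hk'⟩ := hI.stationarity hB H hindep
  exact ⟨m * k, by simpa using hk.mul_left m, by simpa using hk'.mul_left m⟩

end IsFinsetIndep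

/-- The independence of `A` and `D` over the pair `B; C`, written `A ⊥_{B;C} D`. -/
def BiIndep (I : Finset M → Finset M → Finset M → Prop) (A B C D : Finset M) : Prop :=
  I A B (C ∪ D) ∧ I (A ∪ B) C D

namespace BiIndep

theorem symm (hI : IsFinsetIndep G cl I) (H : BiIndep I A B C D) : BiIndep I D C B A := by
  constructor
  · rw [Finset.union_comm]
    exact hI.symm H.2
  · rw [Finset.union_comm]
    exact hI.symm H.1

theorem smul (hI : IsFinsetIndep G cl I) (H : BiIndep I A B C D) (g : G) :
    BiIndep I (g • A) (g • B) (g • C) (g • D) := by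
  simpa only [BiIndep, Finset.smul_finset_union] using And.intro (hI.smul g H.1) (hI.smul g H.2)

variable {A' D' : Finset M}

theorem union (hI : IsFinsetIndep G cl I) (H : BiIndep I A B C D)
    (H' : BiIndep I A' (B ∪ A) (C ∪ D) D') : BiIndep I (A ∪ A') B C (D ∪ D') := by
  have indep_union : ∀ {A B C D A' D' : Finset M}, BiIndep I A B C D →
      BiIndep I A' (B ∪ A) (C ∪ D) D' → I (A ∪ A') B (C ∪ (D ∪ D')) := by
    intro A B C D A' D' H H'
    have hCD : I (A ∪ A') B (C ∪ D) :=
      hI.symm (hI.trans (hI.symm H.1) (hI.symm (hI.mono H'.1 Finset.subset_union_left)))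
    have hD' : I D' (C ∪ D) (B ∪ (A ∪ A')) := by
      rw [← Finset.union_assoc, Finset.union_comm _ A']
      exact hI.symm H'.2
    rw [← Finset.union_assoc]
    refine hI.trans hCD ?_
    rw [Finset.union_comm B]
    exact hI.symm (hI.base_of_union hD')
  refine ⟨indep_union H H', ?_⟩
  rw [Finset.union_comm]
  exact hI.symm (indep_union (H.symm hI) (H'.symm hI))

end BiIndep

/-- The type of `x` over `X` has a realisation that is moved by `γ` as freely as possible. -/
def MovesFreely (cl : ClosureOperator (Set M)) (I : Finset M → Finset M → Finset M → Prop) (γ : G)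
    (X x : Finset M) : Prop :=
  ∃ u : G, AgreeOn cl u 1 X ∧ BiIndep I (u • x) X (γ • X) (γ • u • x)

/-- `γ` moves maximally: every type over a finite set has a realisation that is moved by `γ` as
freely as possible. -/
def MovesMaximally (cl : ClosureOperator (Set M)) (I : Finset M → Finset M → Finset M → Prop)
    (γ : G) : Prop :=
  ∀ X x : Finset M, MovesFreely cl I γ X x

theorem MovesFreely.union (hI : IsFinsetIndep G cl I) {γ : G} {X x y : Finset M}
    (hx : MovesFreely cl I γ X x) (hy : ∀ u : G, MovesFreely cl I γ (X ∪ u • x) (u • y)) :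
    MovesFreely cl I γ X (x ∪ y) := by
  obtain ⟨u, hu, hux⟩ := hx
  obtain ⟨v, hv, hvy⟩ := hy u
  refine ⟨v * u, (hu.mul_left v).trans (by simpa using hv.mono Finset.subset_union_left), ?_⟩
  rw [Finset.smul_finset_union] at hvy
  simpa only [Finset.smul_finset_union, mul_smul,
    hv.smul_finset_eq_self Finset.subset_union_right] using hux.union hI hvy

namespace MovesMaximally

variable {γ : G}

theorem of_singleton (hI : IsFinsetIndep G cl I)
    (H : ∀ (X : Finset M) (a : M), MovesFreely cl I γ X {a}) : MovesMaximally cl I γ :=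
  fun X x => by
    induction x using Finset.induction_on with
    | empty =>
      exact ⟨1, AgreeOn.refl 1 X, hI.symm (hI.mono (hI.self_right _ _) (by simp)),
        hI.mono (hI.self_right _ _) (by simp)⟩
    | insert a x _ ih =>
      rw [Finset.insert_eq, Finset.union_comm]
      exact ih.union hI fun u => by simpa only [Finset.smul_finset_singleton] using H _ _

variable [IsEquivariant G cl]

theorem conj (hI : IsFinsetIndep G cl I) (H : MovesMaximally cl I γ) (h : G) :
    MovesMaximally cl I (h⁻¹ * γ * h) := fun X x => by
  obtain ⟨u, hu, hux⟩ := H (h • X) (h • x)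
  refine ⟨h⁻¹ * u * h, by simpa using (hu.mul_left h⁻¹).mul_right, ?_⟩
  simpa only [mul_smul, smul_inv_smul, inv_smul_smul] using hux.smul hI h⁻¹

theorem inv (hI : IsFinsetIndep G cl I) (H : MovesMaximally cl I γ) :
    MovesMaximally cl I γ⁻¹ := fun X x => by
  obtain ⟨u, hu, hux⟩ := H (γ⁻¹ • X) (γ⁻¹ • x)
  refine ⟨γ * u * γ⁻¹, by simpa using (hu.mul_left γ).mul_right, ?_⟩
  simpa only [mul_smul, smul_inv_smul, inv_smul_smul] using hux.symm hI

end MovesMaximally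

theorem isOpen_setOf_movesFreely [TopologicalSpace G] [IsTopologicalGroup G]
    [HasFixatorTopology G cl] (X x : Finset M) : IsOpen {γ : G | MovesFreely cl I γ X x} := by
  refine (isOpen_iff_agreeOn (cl := cl)).2 fun γ ⟨u, hu, hux⟩ =>
    ⟨X ∪ u • x, fun δ hδ => ⟨u, hu, ?_⟩⟩
  rwa [hδ.smul_finset_eq Finset.subset_union_left, hδ.smul_finset_eq Finset.subset_union_right]

end Independence

section Amalgamation

variable {G M : Type*} [Group G] [MulAction G M] [DecidableEq M] {cl : ClosureOperator (Set M)}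
  {I : Finset M → Finset M → Finset M → Prop}

theorem MovesMaximally.exists_conj_indep (hI : IsFinsetIndep G cl I) {g : G}
    (H : MovesMaximally cl I g) {X Y C : Finset M} (h : I X Y C) (x : Finset M) :
    ∃ a : G, AgreeOn cl a 1 (X ∪ Y) ∧ I ((a⁻¹ * g * a) • x) Y C := by
  obtain ⟨u, hu, hux, -⟩ := H (X ∪ Y) x
  have hx : I (u⁻¹ • g • u • x) (X ∪ Y) x := by
    have := hI.smul u⁻¹ (hI.mono hux Finset.subset_union_right)
    rw [inv_smul_smul, hu.inv_one.smul_finset_eq_self subset_rfl] at this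
    exact hI.symm this
  obtain ⟨v, hv, hvC⟩ := hI.exists_extension Finset.subset_union_left (hI.union_base hx) C
  have hvXY : AgreeOn cl v⁻¹ 1 (X ∪ Y) := (hv.mono Finset.subset_union_left).inv_one
  refine ⟨u * v⁻¹, (hvXY.mul_one_right u).trans hu, ?_⟩
  have hmove : ((u * v⁻¹)⁻¹ * g * (u * v⁻¹)) • x = v • u⁻¹ • g • u • x := by
    simp only [mul_inv_rev, inv_inv, mul_smul,
      hv.inv_one.smul_finset_eq_self Finset.subset_union_right]
  rw [hmove]
  have hC : I C (Y ∪ X) (v • u⁻¹ • g • u • x) := by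
    rw [Finset.union_comm]
    exact hI.symm (hI.mono hvC Finset.subset_union_right)
  exact hI.symm (hI.mono (hI.trans (hI.symm h) hC) Finset.subset_union_right)

variable [IsEquivariant G cl]

theorem MovesMaximally.exists_conj_agreeOn (hI : IsFinsetIndep G cl I) {g : G}
    (H : MovesMaximally cl I g) {X Y x : Finset M} (hY : g • X = Y) {f : G}
    (hf : AgreeOn cl f g X) (hx : I x X Y) (hfx : I (f • x) Y (X ∪ x)) :
    ∃ a : G, AgreeOn cl a 1 (X ∪ Y) ∧ AgreeOn cl (a⁻¹ * g * a) f (x ∪ X) := by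
  obtain ⟨u, hu, -, hu'⟩ := H (X ∪ Y) x
  have huX : AgreeOn cl u 1 X := hu.mono Finset.subset_union_left
  have huY : AgreeOn cl u 1 Y := hu.mono Finset.subset_union_right
  have hfX : f • X = Y := (hf.smul_finset_eq subset_rfl).trans hY
  have hgx : I (g • u • x) Y (X ∪ Y ∪ u • x) := by
    have hgY := hI.smul g (hI.smul_of_agreeOn hx huX huY)
    rw [hY] at hgY
    rw [Finset.smul_finset_union, hY] at hu'
    refine hI.mono (hI.trans hgY (hI.symm hu')) ?_
    rw [Finset.union_comm _ (u • x)]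
    exact Finset.subset_union_right
  have hfu : AgreeOn cl (g * u * f⁻¹) u Y := by
    have hguX : AgreeOn cl (g * u) g (f⁻¹ • Y) := by
      rw [← hfX, inv_smul_smul]
      exact huX.mul_one_right g
    have hgfY : AgreeOn cl (g * f⁻¹) 1 Y := by simpa [hfX] using (hf.inv.mul_left g)
    exact (hguX.mul_right.trans hgfY).trans huY.symm
  obtain ⟨k, hkf, hku⟩ := hI.stationarity_map (C := X ∪ Y ∪ x) hfu
    (hI.mono (hI.union_base hfx) (by grind)) (by
      rw [hfu.smul_finset_eq subset_rfl, huY.smul_finset_eq_self subset_rfl,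
        Finset.smul_finset_union, hu.smul_finset_eq_self subset_rfl]
      simpa only [mul_smul, inv_smul_smul] using hgx)
  refine ⟨k, (hku.mono Finset.subset_union_left).trans hu, ?_⟩
  have hkfx : AgreeOn cl (k * f) (g * u) (x ∪ X) := by
    have : AgreeOn cl k (g * u * f⁻¹) (f • (x ∪ X)) := by rwa [Finset.smul_finset_union, hfX]
    simpa using this.mul_right
  have hgkx : AgreeOn cl (g * k) (g * u) (x ∪ X) := (hku.mono (by grind)).mul_left g
  simpa [mul_assoc] using (hgkx.trans hkfx.symm).mul_left k⁻¹

theorem exists_conj_mul_agreeOn (hI : IsFinsetIndep G cl I) {g₂ g₃ : G}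
    (H₂ : MovesMaximally cl I g₂) (H₃ : MovesMaximally cl I g₃) {Y₁ Y₂ Y₃ x : Finset M}
    (h₂ : g₂ • Y₁ = Y₂) (h₃ : g₃ • Y₂ = Y₃) {f : G} (hf : AgreeOn cl f (g₃ * g₂) Y₁)
    (hx : I x Y₁ Y₂) (hfx : I (f • x) Y₃ Y₂) :
    ∃ a₂ a₃ : G, AgreeOn cl a₂ 1 (Y₁ ∪ Y₂) ∧ AgreeOn cl a₃ 1 (Y₂ ∪ Y₃) ∧
      AgreeOn cl ((a₃⁻¹ * g₃ * a₃) * (a₂⁻¹ * g₂ * a₂)) f (x ∪ Y₁) := by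
  obtain ⟨v, hv, hvx⟩ := hI.existence (g₂ • x) Y₂ (Y₁ ∪ x ∪ (Y₃ ∪ f • x))
  rw [smul_smul] at hvx
  have hvg₂ : AgreeOn cl (v * g₂) g₂ Y₁ := by
    have : AgreeOn cl v 1 (g₂ • Y₁) := by rwa [h₂]
    simpa using this.mul_right
  have hvY₁ : (v * g₂) • Y₁ = Y₂ := (hvg₂.smul_finset_eq subset_rfl).trans h₂
  obtain ⟨a₂, ha₂, hg₂⟩ :=
    H₂.exists_conj_agreeOn hI h₂ hvg₂ hx (hI.mono hvx Finset.subset_union_left)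
  have hf₃ : AgreeOn cl (f * (v * g₂)⁻¹) g₃ Y₂ := by
    have hf' : AgreeOn cl f (g₃ * g₂) ((v * g₂)⁻¹ • Y₂) := by rwa [← hvY₁, inv_smul_smul]
    have hinv : AgreeOn cl (v * g₂)⁻¹ g₂⁻¹ Y₂ := by simpa only [hvY₁] using hvg₂.inv
    simpa only [mul_inv_cancel_right] using hf'.mul hinv
  have hfx' : I ((f * (v * g₂)⁻¹) • (v * g₂) • x) Y₃ (Y₂ ∪ (v * g₂) • x) := by
    rw [smul_smul, inv_mul_cancel_right]
    refine hI.trans hfx (hI.symm ?_)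
    rw [Finset.union_comm]
    exact hI.base_of_union (hI.mono hvx Finset.subset_union_right)
  obtain ⟨a₃, ha₃, hg₃⟩ :=
    H₃.exists_conj_agreeOn hI h₃ hf₃ (hI.mono hvx (by grind)) hfx'
  refine ⟨a₂, a₃, ha₂, ha₃, ?_⟩
  rw [← hvY₁, ← Finset.smul_finset_union] at hg₃
  have hg₃' : AgreeOn cl ((a₃⁻¹ * g₃ * a₃) * (v * g₂)) f (x ∪ Y₁) := by
    simpa only [inv_mul_cancel_right] using hg₃.mul_right
  exact (hg₂.mul_left _).trans hg₃'

theorem exists_conj_mul_conj_mul_agreeOn (hI : IsFinsetIndep G cl I) {g₁ g₂ g₃ g₄ : G}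
    (H₁ : MovesMaximally cl I g₁) (H₂ : MovesMaximally cl I g₂) (H₃ : MovesMaximally cl I g₃)
    (H₄ : MovesMaximally cl I g₄) {Y₀ Y₁ Y₂ Y₃ Y₄ : Finset M} (h₁ : g₁ • Y₀ = Y₁)
    (h₂ : g₂ • Y₁ = Y₂) (h₃ : g₃ • Y₂ = Y₃) (h₄ : g₄ • Y₃ = Y₄) (hY₀ : I Y₀ Y₁ Y₂)
    (hY₄ : I Y₄ Y₃ Y₂) {k : G} (hk : AgreeOn cl k (g₄ * g₃ * g₂ * g₁) Y₀) (E : Finset M) :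
    ∃ a₁ a₂ a₃ a₄ : G, AgreeOn cl a₁ 1 Y₁ ∧ AgreeOn cl a₂ 1 Y₁ ∧ AgreeOn cl a₃ 1 Y₃ ∧
      AgreeOn cl a₄ 1 Y₃ ∧ AgreeOn cl
        ((a₄⁻¹ * g₄ * a₄) * (a₃⁻¹ * g₃ * a₃) * (a₂⁻¹ * g₂ * a₂) * (a₁⁻¹ * g₁ * a₁)) k E := by
  obtain ⟨a₁, ha₁, hE₁⟩ := H₁.exists_conj_indep hI hY₀ E
  obtain ⟨a₄, ha₄, hE₄⟩ := (H₄.inv hI).exists_conj_indep hI hY₄ (k • E)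
  have hg₁ : AgreeOn cl (a₁⁻¹ * g₁ * a₁) g₁ Y₀ := AgreeOn.conj (by rwa [h₁])
  have hg₄ : AgreeOn cl (a₄⁻¹ * g₄⁻¹ * a₄) g₄⁻¹ Y₄ :=
    AgreeOn.conj (by rwa [← h₄, inv_smul_smul, h₄])
  have hY₁ : (a₁⁻¹ * g₁ * a₁) • Y₀ = Y₁ := (hg₁.smul_finset_eq subset_rfl).trans h₁
  have hkY₀ : k • Y₀ = Y₄ := by
    rw [hk.smul_finset_eq subset_rfl, mul_smul, mul_smul, mul_smul, h₁, h₂, h₃, h₄]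
  have hf : AgreeOn cl (a₄⁻¹ * g₄⁻¹ * a₄ * (k * (a₁⁻¹ * g₁ * a₁)⁻¹)) (g₃ * g₂) Y₁ := by
    have hk₁ : AgreeOn cl (k * (a₁⁻¹ * g₁ * a₁)⁻¹) (g₄ * g₃ * g₂) Y₁ := by
      have hk' : AgreeOn cl k (g₄ * g₃ * g₂ * g₁) ((a₁⁻¹ * g₁ * a₁)⁻¹ • Y₁) := by
        rwa [← hY₁, inv_smul_smul]
      have hinv : AgreeOn cl (a₁⁻¹ * g₁ * a₁)⁻¹ g₁⁻¹ Y₁ := by simpa only [hY₁] using hg₁.inv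
      simpa only [mul_inv_cancel_right] using hk'.mul hinv
    have hg₄' : AgreeOn cl (a₄⁻¹ * g₄⁻¹ * a₄) g₄⁻¹ ((k * (a₁⁻¹ * g₁ * a₁)⁻¹) • Y₁) := by
      rwa [mul_smul, ← hY₁, inv_smul_smul, hkY₀]
    simpa only [mul_assoc, inv_mul_cancel_left] using hg₄'.mul hk₁
  obtain ⟨a₂, a₃, ha₂, ha₃, hE⟩ := exists_conj_mul_agreeOn hI H₂ H₃ h₂ h₃ hf hE₁
    (by rwa [smul_smul, mul_assoc, inv_mul_cancel_right, mul_smul])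
  refine ⟨a₁, a₂, a₃, a₄, ha₁.mono Finset.subset_union_right, ha₂.mono Finset.subset_union_left,
    ha₃.mono Finset.subset_union_right, ha₄.mono Finset.subset_union_right, ?_⟩
  simpa [mul_assoc] using
    ((hE.mono Finset.subset_union_left).mul_right.mul_left (a₄⁻¹ * g₄ * a₄))

end Amalgamation

section ConjProd

variable {G M : Type*} [Group G]

/-- The product of the conjugates of `γ` by the entries of a tuple. -/
def conjProd (γ : G) {n : ℕ} (h : Fin n → G) : G :=
  (List.ofFn fun i => (h i)⁻¹ * γ * h i).prod

theorem conjProd_mem_conjugatesOf_pow (γ : G) {n : ℕ} (h : Fin n → G) :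
    conjProd γ h ∈ conjugatesOf γ ^ n :=
  Set.mem_pow.2 ⟨fun i => ⟨(h i)⁻¹ * γ * h i, isConj_iff.2 ⟨(h i)⁻¹, by rw [inv_inv]⟩⟩, rfl⟩

theorem continuous_conjProd [TopologicalSpace G] [IsTopologicalGroup G] (γ : G) (n : ℕ) :
    Continuous fun h : Fin n → G => conjProd γ h := by
  simp only [conjProd, List.ofFn_eq_map]
  exact continuous_list_prod _ fun i _ => by fun_prop

variable [MulAction G M] [DecidableEq M] {cl : ClosureOperator (Set M)}
  {I : Finset M → Finset M → Finset M → Prop} {γ : G}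

theorem exists_indep_chain (hI : IsFinsetIndep G cl I) (g₁ g₂ g₃ g₄ : G) (F : Finset M) :
    ∃ (a₁ a₄ : G) (Y₀ Y₁ Y₂ Y₃ Y₄ : Finset M), AgreeOn cl a₁ 1 F ∧ AgreeOn cl a₄ 1 F ∧
      F ⊆ Y₁ ∧ F ⊆ Y₃ ∧ (a₁⁻¹ * g₁ * a₁) • Y₀ = Y₁ ∧ g₂ • Y₁ = Y₂ ∧ g₃ • Y₂ = Y₃ ∧
      (a₄⁻¹ * g₄ * a₄) • Y₃ = Y₄ ∧ I Y₀ Y₁ Y₂ ∧ I Y₄ Y₃ Y₂ := by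
  set Y₂ := F ∪ g₂ • F ∪ g₃⁻¹ • F with hY₂
  have hF₁ : F ⊆ g₂⁻¹ • Y₂ := by
    rw [hY₂, Finset.smul_finset_union, Finset.smul_finset_union, inv_smul_smul]
    grind
  have hF₃ : F ⊆ g₃ • Y₂ := by
    rw [hY₂, Finset.smul_finset_union, Finset.smul_finset_union, smul_inv_smul]
    grind
  obtain ⟨u, hu, hY₀⟩ := hI.existence (g₁⁻¹ • g₂⁻¹ • Y₂) (g₂⁻¹ • Y₂) Y₂
  obtain ⟨v, hv, hY₄⟩ := hI.existence (g₄ • g₃ • Y₂) (g₃ • Y₂) Y₂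
  refine ⟨u⁻¹, v⁻¹, u • g₁⁻¹ • g₂⁻¹ • Y₂, g₂⁻¹ • Y₂, Y₂, g₃ • Y₂, v • g₄ • g₃ • Y₂,
    (hu.mono hF₁).inv_one, (hv.mono hF₃).inv_one, hF₁, hF₃, ?_, smul_inv_smul g₂ Y₂, rfl, ?_,
    hY₀, hY₄⟩
  · simp only [mul_smul, inv_inv, inv_smul_smul, smul_inv_smul, hu.smul_finset_eq_self subset_rfl]
  · simp only [mul_smul, inv_inv, hv.inv_one.smul_finset_eq_self subset_rfl]

variable [IsEquivariant G cl] [TopologicalSpace G] [IsTopologicalGroup G] [HasFixatorTopology G cl]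

theorem mem_closure_image_conjProd (hI : IsFinsetIndep G cl I) (H : MovesMaximally cl I γ)
    {h : Fin 4 → G} {F Y₀ Y₁ Y₂ Y₃ Y₄ : Finset M} (h₁ : ((h 3)⁻¹ * γ * h 3) • Y₀ = Y₁)
    (h₂ : ((h 2)⁻¹ * γ * h 2) • Y₁ = Y₂) (h₃ : ((h 1)⁻¹ * γ * h 1) • Y₂ = Y₃)
    (h₄ : ((h 0)⁻¹ * γ * h 0) • Y₃ = Y₄) (hY₀ : I Y₀ Y₁ Y₂) (hY₄ : I Y₄ Y₃ Y₂)
    (hF₁ : F ⊆ Y₁) (hF₃ : F ⊆ Y₃) {k : G} (hk : AgreeOn cl k (conjProd γ h) Y₀) :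
    k ∈ closure (conjProd γ '' {p | ∀ i, AgreeOn cl (p i) (h i) F}) := by
  have hk' : AgreeOn cl k (((h 0)⁻¹ * γ * h 0) * ((h 1)⁻¹ * γ * h 1) * ((h 2)⁻¹ * γ * h 2) *
      ((h 3)⁻¹ * γ * h 3)) Y₀ := by
    simpa [conjProd, List.ofFn_succ, mul_assoc] using hk
  refine (mem_closure_iff_agreeOn (cl := cl)).2 fun E => ?_
  obtain ⟨a₁, a₂, a₃, a₄, ha₁, ha₂, ha₃, ha₄, ha⟩ := exists_conj_mul_conj_mul_agreeOn hI
    (H.conj hI (h 3)) (H.conj hI (h 2)) (H.conj hI (h 1)) (H.conj hI (h 0)) h₁ h₂ h₃ h₄ hY₀ hY₄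
    hk' E
  refine ⟨_, mem_image_of_mem _ (x := ![h 0 * a₄, h 1 * a₃, h 2 * a₂, h 3 * a₁]) ?_, ?_⟩
  · simp only [mem_ofPred_eq, Fin.forall_fin_succ]
    exact ⟨(ha₄.mono hF₃).mul_one_right _, (ha₃.mono hF₃).mul_one_right _,
      (ha₂.mono hF₁).mul_one_right _, (ha₁.mono hF₁).mul_one_right _, fun i => i.elim0⟩
  · simpa [conjProd, List.ofFn_succ, mul_assoc] using ha

theorem isNearlyFeeblyOpen_conjProd (hI : IsFinsetIndep G cl I) (H : MovesMaximally cl I γ) :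
    IsNearlyFeeblyOpen fun h : Fin 4 → G => conjProd γ h := by
  rintro U hU ⟨h, hh⟩
  obtain ⟨F, hF⟩ := exists_agreeOn_of_mem_nhds_pi (cl := cl) (hU.mem_nhds hh)
  obtain ⟨a₁, a₄, Y₀, Y₁, Y₂, Y₃, Y₄, ha₁, ha₄, hF₁, hF₃, h₁, h₂, h₃, h₄, hY₀, hY₄⟩ :=
    exists_indep_chain hI ((h 3)⁻¹ * γ * h 3) ((h 2)⁻¹ * γ * h 2) ((h 1)⁻¹ * γ * h 1)
      ((h 0)⁻¹ * γ * h 0) F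
  let h' : Fin 4 → G := ![h 0 * a₄, h 1, h 2, h 3 * a₁]
  have hh' (i : Fin 4) : AgreeOn cl (h' i) (h i) F := by
    fin_cases i
    exacts [ha₄.mul_one_right _, AgreeOn.refl _ _, AgreeOn.refl _ _, ha₁.mul_one_right _]
  have hsub : {k | AgreeOn cl k (conjProd γ h') Y₀} ⊆ closure (conjProd γ '' U) := fun k hk => by
    refine closure_mono (image_mono fun p hp => hF p fun i => (hp i).trans (hh' i))
      (mem_closure_image_conjProd hI H (h := h') ?_ h₂ h₃ ?_ hY₀ hY₄ hF₁ hF₃ hk)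
    · simpa [h', mul_assoc] using h₁
    · simpa [h', mul_assoc] using h₄
  exact ⟨conjProd γ h', mem_interior_iff_mem_nhds.2
    ((nhds_hasBasis_agreeOn cl _).mem_iff.2 ⟨Y₀, trivial, hsub⟩)⟩

theorem denseRange_conjProd (hI : IsFinsetIndep G cl I) (H : MovesMaximally cl I γ)
    (hfix : ∀ g : G, AgreeOn cl g 1 ∅) : DenseRange fun h : Fin 4 → G => conjProd γ h := by
  intro k
  refine closure_mono (image_subset_range _ _) (mem_closure_image_conjProd hI H (h := 1) (F := ∅)
    (Y₀ := ∅) (Y₁ := ∅) (Y₂ := ∅) (Y₃ := ∅) (Y₄ := ∅) ?_ ?_ ?_ ?_ (hI.self_right ∅ ∅)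
    (hI.self_right ∅ ∅) subset_rfl subset_rfl ((hfix k).trans (hfix _).symm))
  all_goals exact Finset.smul_finset_empty _

theorem mem_conjugatesOf_pow_eight [FaithfulSMul G M] [IsCompletelyPseudoMetrizableSpace G]
    (hI : IsFinsetIndep G cl I) (H : MovesMaximally cl I γ) (hfix : ∀ g : G, AgreeOn cl g 1 ∅)
    (k : G) : k ∈ conjugatesOf γ ^ 8 := by
  have := t2Space_of_hasFixatorTopology cl (G := G)
  have hcont := continuous_conjProd γ 4
  have hopen := isNearlyFeeblyOpen_conjProd hI H
  obtain ⟨p, q, hpq⟩ := exists_eq_of_isNearlyFeeblyOpen hcont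
    (hcont.inv.const_mul k) hopen
    (hopen.homeomorph_comp ((Homeomorph.inv G).trans (Homeomorph.mulLeft k)))
    (denseRange_conjProd hI H hfix)
  rw [show 8 = 4 + 4 from rfl, pow_add, ← eq_mul_inv_iff_mul_eq.1 hpq]
  exact Set.mul_mem_mul (conjProd_mem_conjugatesOf_pow γ p) (conjProd_mem_conjugatesOf_pow γ q)

end ConjProd

section AlmostMaximal

variable {G M : Type*} [Group G] [MulAction G M] [DecidableEq M] {cl : ClosureOperator (Set M)}
  {I : Finset M → Finset M → Finset M → Prop} {g : G}

/-- `g` moves almost maximally with respect to a relation between finite sets: every type of an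
element over a finite set has a realisation that is independent of its image under `g`. -/
def IsAlmostMaximal (cl : ClosureOperator (Set M)) (I : Finset M → Finset M → Finset M → Prop)
    (g : G) : Prop :=
  ∀ (B : Finset M) (a : M), ∃ f : G, AgreeOn cl f 1 B ∧ I {f • a} B {g • f • a}

namespace IsAlmostMaximal

theorem exists_extension (hI : IsFinsetIndep G cl I) (hg : IsAlmostMaximal cl I g)
    {B C : Finset M} {a : M} (hBC : B ⊆ C) (H : I {a} B C) (D : Finset M) :
    ∃ f : G, AgreeOn cl f 1 C ∧ I {f • a} B (C ∪ D ∪ {g • f • a}) := by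
  obtain ⟨v, hv, hvD⟩ := hI.exists_extension hBC H D
  rw [Finset.smul_finset_singleton] at hvD
  obtain ⟨w, hw, hwg⟩ := hg (C ∪ D) (v • a)
  have hwC : AgreeOn cl w 1 C := hw.mono Finset.subset_union_left
  have hwD := hI.smul_of_agreeOn hvD (hwC.mono hBC) hw
  rw [Finset.smul_finset_singleton] at hwD
  refine ⟨w * v, (hv.mul_one_right w).trans hwC, ?_⟩
  rw [mul_smul]
  exact hI.trans_of_subset (hBC.trans Finset.subset_union_left) hwD hwg

theorem exists_conj_indep (hI : IsFinsetIndep G cl I) (hg : IsAlmostMaximal cl I g)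
    {P Y : Finset M} {x : M} (hY : Y ⊆ P) (hgY : g • Y ⊆ P) (hx : I {x} Y P) :
    ∃ f : G, AgreeOn cl f 1 P ∧ I {(f⁻¹ * g * f) • x} (g • Y) (P ∪ {x}) := by
  obtain ⟨f, hf, hfx⟩ := hg.exists_extension hI hY hx (g⁻¹ • P)
  have hgfP : I {g • f • x} (g • Y) P := by
    simpa only [Finset.smul_finset_singleton, smul_inv_smul]
      using hI.smul g (hI.mono hfx (C := g⁻¹ • P) (by grind))
  have hgfx : I {g • f • x} P {f • x} :=
    hI.symm (hI.mono (hI.base_mono hfx hY (by grind)) Finset.subset_union_right)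
  have := hI.smul f⁻¹ (hI.trans_of_subset hgY hgfP hgfx)
  refine ⟨f, hf, ?_⟩
  simpa only [Finset.smul_finset_union, Finset.smul_finset_singleton, inv_smul_smul, mul_smul,
    hf.inv_one.smul_finset_eq_self hgY, hf.inv_one.smul_finset_eq_self subset_rfl] using this

theorem exists_movesFreely (hI : IsFinsetIndep G cl I) (hg : IsAlmostMaximal cl I g) (h : G)
    (F X : Finset M) (a : M) :
    ∃ f : G, AgreeOn cl f 1 F ∧ MovesFreely cl I (f⁻¹ * g * f * h) X {a} := by
  set P := F ∪ h • X ∪ g • h • X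
  have hhX : h • X ⊆ P := by grind
  have hghX : g • h • X ⊆ P := by grind
  obtain ⟨u, hu, huP⟩ := hI.existence {a} X (P ∪ h⁻¹ • P)
  rw [Finset.smul_finset_singleton] at huP
  set b := u • a
  have hhb : I {h • b} (h • X) P := by
    simpa only [Finset.smul_finset_singleton, smul_inv_smul]
      using hI.smul h (hI.mono huP Finset.subset_union_right)
  obtain ⟨f, hf, hfb⟩ := hg.exists_conj_indep hI hhX hghX hhb
  obtain ⟨z, hz, hzb⟩ := hI.exists_extension (hghX.trans Finset.subset_union_left) hfb ({b} ∪ X)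
  have hzP : AgreeOn cl z⁻¹ 1 P := (hz.mono Finset.subset_union_left).inv_one
  have hfz : AgreeOn cl (f * z⁻¹) 1 P := (hzP.mul_one_right f).trans hf
  refine ⟨f * z⁻¹, hfz.mono (by grind), u, hu, ?_⟩
  have hX : ((f * z⁻¹)⁻¹ * g * (f * z⁻¹) * h) • X = g • h • X := by
    rw [mul_smul, mul_smul, mul_smul, hfz.smul_finset_eq_self hhX,
      hfz.inv_one.smul_finset_eq_self hghX]
  have hb : ((f * z⁻¹)⁻¹ * g * (f * z⁻¹) * h) • b = z • (f⁻¹ * g * f) • h • b := by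
    have : z⁻¹ • h • b = h • b := by simpa using hz.inv_one.smul_eq (x := h • b) (by simp)
    simp only [mul_inv_rev, inv_inv, mul_smul, this]
  rw [Finset.smul_finset_singleton, Finset.smul_finset_singleton, hX, hb]
  rw [Finset.smul_finset_singleton] at hzb
  refine ⟨hI.trans (hI.mono huP (by grind)) ?_, hI.symm (hI.mono hzb Finset.subset_union_right)⟩
  rw [Finset.union_comm]
  exact hI.symm (hI.base_of_union (hI.mono hzb (by grind)))

variable [IsEquivariant G cl]

theorem conj (hI : IsFinsetIndep G cl I) (hg : IsAlmostMaximal cl I g) (h : G) :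
    IsAlmostMaximal cl I (h⁻¹ * g * h) := fun B a => by
  obtain ⟨f, hf, hfa⟩ := hg (h • B) (h • a)
  refine ⟨h⁻¹ * f * h, by simpa using (hf.mul_left h⁻¹).mul_right, ?_⟩
  simpa only [mul_smul, smul_inv_smul, inv_smul_smul, Finset.smul_finset_singleton]
    using hI.smul h⁻¹ hfa

variable [TopologicalSpace G] [IsTopologicalGroup G] [HasFixatorTopology G cl]

theorem dense_setOf_movesFreely (hI : IsFinsetIndep G cl I) (hg : IsAlmostMaximal cl I g) (h : G)
    (X : Finset M) (a : M) : Dense {f : G | MovesFreely cl I (f⁻¹ * g * f * h) X {a}} := fun k => by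
  refine (mem_closure_iff_agreeOn (cl := cl)).2 fun F => ?_
  obtain ⟨f, hf, hfX⟩ := (hg.conj hI k).exists_movesFreely hI h F X a
  exact ⟨k * f, by simpa [mul_assoc] using hfX, hf.mul_one_right k⟩

theorem exists_movesMaximally [Countable M] [BaireSpace G] (hI : IsFinsetIndep G cl I)
    (hg : IsAlmostMaximal cl I g) (h : G) : ∃ f : G, MovesMaximally cl I (f⁻¹ * g * f * h) := by
  have hopen (p : Finset M × M) : IsOpen {f : G | MovesFreely cl I (f⁻¹ * g * f * h) p.1 {p.2}} :=
    (isOpen_setOf_movesFreely p.1 {p.2}).preimage (by fun_prop)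
  obtain ⟨f, hf⟩ := (dense_iInter_of_isOpen hopen fun p =>
    hg.dense_setOf_movesFreely hI h p.1 p.2).nonempty
  exact ⟨f, MovesMaximally.of_singleton hI fun X a => mem_iInter.1 hf (X, a)⟩

end IsAlmostMaximal

theorem IsAlmostMaximal.mem_conjugatesOf_pow_sixteen [Countable M] [FaithfulSMul G M]
    [IsEquivariant G cl] (hlim : HasPointwiseLimits G M) (hI : IsFinsetIndep G cl I)
    (hfix : ∀ g : G, AgreeOn cl g 1 ∅) (hg : IsAlmostMaximal cl I g) (k : G) :
    k ∈ conjugatesOf g ^ 16 := by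
  let := (fixatorFilterBasis G cl).topology
  have := (fixatorFilterBasis G cl).isTopologicalGroup
  have : HasFixatorTopology G cl := hasFixatorTopology_fixatorFilterBasis
  have := hlim.isCompletelyPseudoMetrizableSpace cl
  obtain ⟨f, hf⟩ := hg.exists_movesMaximally hI g
  have hsub : conjugatesOf (f⁻¹ * g * f * g) ⊆ conjugatesOf g ^ 2 := by
    intro x hx
    obtain ⟨c, rfl⟩ := isConj_iff.1 hx
    rw [sq, ← conj_mul]
    refine Set.mul_mem_mul (isConj_iff.2 ⟨c * f⁻¹, ?_⟩) (isConj_iff.2 ⟨c, rfl⟩)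
    simp [mul_assoc]
  rw [show 16 = 2 * 8 from rfl, pow_mul]
  exact Set.pow_subset_pow_left hsub (mem_conjugatesOf_pow_eight hI hf hfix k)

end AlmostMaximal

section Automorphisms

variable {L : FirstOrder.Language.{u, v}} {M : Type w} [L.Structure M]

instance autMulAction : MulAction (M ≃[L] M) M where
  smul f x := f x
  one_smul _ := rfl
  mul_smul _ _ _ := rfl

instance autFaithfulSMul : FaithfulSMul (M ≃[L] M) M :=
  ⟨fun h => FirstOrder.Language.Equiv.ext h⟩

theorem aut_hasPointwiseLimits : HasPointwiseLimits (M ≃[L] M) M := by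
  intro u hu hu'
  choose l hl using hu
  choose l' hl' using hu'
  have hinv (x : M) : l' (l x) = x ∧ l (l' x) = x := by
    constructor
    · obtain ⟨n, hn, hn'⟩ := ((hl x).and (hl' (l x))).exists
      rw [← hn', ← hn, inv_smul_smul]
    · obtain ⟨n, hn, hn'⟩ := ((hl' x).and (hl (l' x))).exists
      rw [← hn', ← hn, smul_inv_smul]
  have htuple {k : ℕ} (xs : Fin k → M) : ∀ᶠ n in atTop, ⇑(u n) ∘ xs = l ∘ xs := by
    filter_upwards [eventually_all.2 fun i => hl (xs i)] with n hn
    exact funext hn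
  refine ⟨⟨⟨l, l', fun x => (hinv x).1, fun x => (hinv x).2⟩, fun f xs => ?_, fun r xs => ?_⟩, hl⟩
  · obtain ⟨n, hn, hn'⟩ := ((hl (FirstOrder.Language.Structure.funMap f xs)).and (htuple xs)).exists
    exact hn.symm.trans (((u n).map_fun f xs).trans (congrArg _ hn'))
  · obtain ⟨n, hn⟩ := (htuple xs).exists
    exact hn ▸ (u n).map_rel r xs

variable {cl : ClosureOperator (Set M)} {Ind : Set M → Set M → Set M → Prop}

theorem IsInvariant.isEquivariant (hinv : IsInvariant L cl) : IsEquivariant (M ≃[L] M) cl :=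
  ⟨hinv⟩

theorem closure_mem_finClosed (cl : ClosureOperator (Set M)) (F : Finset M) :
    cl (F : Set M) ∈ finClosed cl :=
  ⟨F, F.finite_toSet, rfl⟩

theorem IsInvariant.closure_smul_finset [DecidableEq M] (hinv : IsInvariant L cl) (f : M ≃[L] M)
    (F : Finset M) :
    cl ((f • F : Finset M) : Set M) = f '' cl (F : Set M) := by
  rw [Finset.coe_smul_finset]
  exact hinv f F

theorem closure_finset_union [DecidableEq M] (cl : ClosureOperator (Set M)) (E F : Finset M) :
    cl ((E ∪ F : Finset M) : Set M) = cl (cl (E : Set M) ∪ cl (F : Set M)) := by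
  rw [Finset.coe_union]
  exact (cl.closure_sup_closure _ _).symm

namespace IsStationaryIndep

theorem closure_union_iff [DecidableEq M] (hInd : IsStationaryIndep L cl Ind)
    {A B C D : Finset M} :
    Ind (cl A) (cl B) (cl ((C ∪ D : Finset M) : Set M)) ↔
      Ind (cl A) (cl B) (cl C) ∧ Ind (cl A) (cl ((B ∪ C : Finset M) : Set M)) (cl D) := by
  have mem := closure_mem_finClosed cl
  rw [closure_finset_union, closure_finset_union]
  exact ⟨hInd.monotonicity _ (mem A) _ (mem B) _ (mem C) _ (mem D),
    fun H => hInd.transitivity _ (mem A) _ (mem B) _ (mem C) _ (mem D) H.1 H.2⟩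

theorem closure_self_right (hInd : IsStationaryIndep L cl Ind) (hinv : IsInvariant L cl)
    (A B : Finset M) : Ind (cl A) (cl B) (cl B) := by
  classical
  have := hinv.isEquivariant
  have mem := closure_mem_finClosed cl
  obtain ⟨f, hf, hAB⟩ := hInd.existence _ (mem A) _ (mem B) _ (mem B)
  have hB : f⁻¹ • B = B := (show AgreeOn cl f 1 B from hf).inv_one.smul_finset_eq_self subset_rfl
  rw [← hinv.closure_smul_finset] at hAB
  have := hInd.invariance f⁻¹ _ (mem (f • A)) _ (mem B) _ (mem B) hAB
  rwa [← hinv.closure_smul_finset, ← hinv.closure_smul_finset, inv_smul_smul, hB] at this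

theorem closure_union_base [DecidableEq M] (hInd : IsStationaryIndep L cl Ind)
    (hinv : IsInvariant L cl) {A B C : Finset M} (H : Ind (cl A) (cl B) (cl C)) :
    Ind (cl ((A ∪ B : Finset M) : Set M)) (cl B) (cl C) := by
  have mem := closure_mem_finClosed cl
  have hBA : Ind (cl C) (cl B) (cl ((B ∪ A : Finset M) : Set M)) := by
    refine hInd.closure_union_iff.2 ⟨hInd.closure_self_right hinv C B, ?_⟩
    rw [Finset.union_self]
    exact hInd.symmetry _ (mem A) _ (mem B) _ (mem C) H
  rw [Finset.union_comm]
  exact hInd.symmetry _ (mem C) _ (mem B) _ (mem (B ∪ A)) hBA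

theorem isFinsetIndep [DecidableEq M] (hInd : IsStationaryIndep L cl Ind)
    (hinv : IsInvariant L cl) :
    IsFinsetIndep (M ≃[L] M) cl fun A B C => Ind (cl A) (cl B) (cl C) where
  smul f A B C H := by
    have mem := closure_mem_finClosed cl
    simpa only [hinv.closure_smul_finset] using
      hInd.invariance f _ (mem A) _ (mem B) _ (mem C) H
  symm := hInd.symmetry _ (closure_mem_finClosed cl _) _ (closure_mem_finClosed cl _) _
    (closure_mem_finClosed cl _)
  union_iff := hInd.closure_union_iff
  self_right := hInd.closure_self_right hinv
  existence A B C := by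
    have mem := closure_mem_finClosed cl
    obtain ⟨f, hf, H⟩ := hInd.existence _ (mem A) _ (mem B) _ (mem C)
    exact ⟨f, hf, by rwa [hinv.closure_smul_finset]⟩
  stationarity {A B C f} hf H H' := by
    have mem := closure_mem_finClosed cl
    have hsub (A : Finset M) : cl (B : Set M) ⊆ cl ((A ∪ B : Finset M) : Set M) :=
      cl.monotone (Finset.coe_subset.2 Finset.subset_union_right)
    have himage : f '' cl ((A ∪ B : Finset M) : Set M) = cl ((f • A ∪ B : Finset M) : Set M) := by
      rw [← hinv.closure_smul_finset, Finset.smul_finset_union, hf.smul_finset_eq_self subset_rfl]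
    exact hInd.stationarity _ (mem _) _ (mem _) _ (mem B) _ (mem C) (hsub A) (hsub _)
      (hInd.closure_union_base hinv H) (hInd.closure_union_base hinv H') f himage hf

end IsStationaryIndep

theorem MovesAlmostMaximally.isAlmostMaximal (hInd : IsStationaryIndep L cl Ind)
    (hinv : IsInvariant L cl) {g : M ≃[L] M} (hg : MovesAlmostMaximally cl Ind g) :
    IsAlmostMaximal cl (fun A B C => Ind (cl A) (cl B) (cl C)) g := by
  classical
  intro B a
  obtain ⟨f, hf, H⟩ := hg _ (closure_mem_finClosed cl B) a
  refine ⟨f, hf, ?_⟩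
  have hclosure : cl ({f a} ∪ cl (B : Set M)) = cl (({f • a} ∪ B : Finset M) : Set M) := by
    rw [Finset.coe_union, Finset.coe_singleton]
    exact cl.closure_sup_closure_right _ _
  rw [hInd.compat_closure _ (finite_singleton _) _ (closure_mem_finClosed cl B) _
    ⟨_, finite_singleton _, rfl⟩, hclosure] at H
  refine (hInd.isFinsetIndep hinv).mono_left (D := {f • a} ∪ B) ?_ Finset.subset_union_left
  rwa [Finset.coe_singleton]

end Automorphisms

end StatIndep

theorem theorem2p7_general {L : FirstOrder.Language.{u, v}} {M : Type w} [L.Structure M]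
    [Countable M] (cl : ClosureOperator (Set M)) (hinv : StatIndep.IsInvariant L cl)
    (Ind : Set M → Set M → Set M → Prop) (hInd : StatIndep.IsStationaryIndep L cl Ind)
    (hfix : ∀ f : M ≃[L] M, StatIndep.Fixes f (cl ∅)) (g : M ≃[L] M)
    (hg : StatIndep.MovesAlmostMaximally cl Ind g) (k : M ≃[L] M) :
    ∃ h : Fin 16 → (M ≃[L] M), k = (List.ofFn fun i => (h i)⁻¹ * g * h i).prod := by
  classical
  have := hinv.isEquivariant
  have hfix' (f : M ≃[L] M) : StatIndep.AgreeOn cl f 1 ∅ :=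
    fun x hx => hfix f x (by simpa using hx)
  obtain ⟨c, rfl⟩ := Set.mem_pow.1 ((hg.isAlmostMaximal hInd hinv).mem_conjugatesOf_pow_sixteen
    StatIndep.aut_hasPointwiseLimits (hInd.isFinsetIndep hinv) hfix' k)
  choose h hh using fun i => isConj_iff.1 (c i).2
  exact ⟨fun i => (h i)⁻¹, by simp only [inv_inv, hh]⟩

theorem theorem2p7 {L : FirstOrder.Language.{u, v}} {M : Type w} [L.Structure M] [Countable M]
    (cl : ClosureOperator (Set M))
    (hinv : StatIndep.IsInvariant L cl)
    (hfin : StatIndep.IsFinitary cl)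
    (hdcl : StatIndep.SubsumesDcl L cl)
    (Ind : Set M → Set M → Set M → Prop)
    (hInd : StatIndep.IsStationaryIndep L cl Ind)
    (hfix : ∀ f : M ≃[L] M, StatIndep.Fixes f (cl ∅))
    (g : M ≃[L] M) (hg : StatIndep.MovesAlmostMaximally cl Ind g)
    (k : M ≃[L] M) :
    ∃ h : Fin 16 → (M ≃[L] M), k = (List.ofFn fun i => (h i)⁻¹ * g * h i).prod :=
  theorem2p7_general cl hinv Ind hInd hfix g hg k
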